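/- Let $G=(V,E,\tau,\mu)$ be a finite undirected property graph ($E$ a set of unordered pairs, $\tau$ labelling vertices and edges, $\mu$ giving them property values) and let $q=(V_q,E_q,\tau_q)$ be a finite query graph, connected or not, which may in addition constrain the property values of the images of its vertices and edges. A match of $q$ in $G$ is an injection $f:V_q\to V$ that preserves vertex labels, satisfies the constraints, maps each edge of $q$ to an edge of $G$ with the same label, and is such that each edge of $G$ between vertices of $f(V_q)$ is the image of an edge of $q$. Let $\mathcal M$ be the set of all matches, and let $\mathcal E=\{f(V_q): f\in\mathcal M\}$ be the set of hyperedges of $\mathrm{SOURCE}(G,q)$, i.e. the vertex sets of the induced subgraphs of $G$ isomorphic to $q$. $\mathrm{SOURCE}_{\mathrm{fas}}(G,q)$ is the following algorithm. (Filtering.) A candidate space consists of candidate vertices $v\in C(u)$ for $u\in V_q$ and candidate edges $(u,v)-(u',v')$ lying over pairs of an edge $uu'$ of $q$ and an edge $vv'$ of $G$. Start with all candidates that agree in labels and satisfy the constraints. Then carry out finitely many removals, in any order and stopped at any time: remove a candidate vertex $(u,v)$ (with its candidate edges) if for some label $v$ has fewer neighbours with this label than $u$, or if for some neighbour $u'$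 of $u$ there is no candidate edge $(u,v)-(u',v')$; remove a candidate edge $(u,v)-(u',v')$ if some triangle of $q$ through $uu'$, or some four-cycle of $q$ through $uu'$ together with those of its chords that are edges of $q$, does not lift to a triangle or four-cycle (with chords) of candidate edges through it, on distinct vertices of $G$, or if the neighbours of $u$ cannot be assigned distinct vertices of $G$ along candidate edges at $(u,v)$ with $u'$ assigned to $v'$. (Counting.) Choose any rooted spanning tree $T$ of $q$ (if $q$ is disconnected: a rooted spanning tree of each component). Let $D(u,v)=\prod_{c}\sum_{w} D(c,w)$, where $c$ ranges over the children of $u$ in $T$ and $w$ over the vertices with a candidate edge $(u,v)-(c,w)$, and let $W=\prod_{r\text{ root}}\sum_{v\in C(r)}D(r,v)$. (Sampling.) In one trial, choose the images of the query vertices, parents before children: for a root $r$ choose $v\in C(r)$ with probability proportional to $D(r,v)$; for a child $c$ of $u$, where $u$ was mapped to $v$, choose $w$ with a candidate edge $(u,v)-(c,w)$ with probability proportional to $D(c,w)$. The trial fails if all weights of a choice vanish. If the resulting map is a match, it is recorded; otherwise the trial fails. Trials are repeated independently, at most $n$ times, where a rule depending only on the successes and failures so far may end the run earlier. The output is the hypergraph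 whose hyperedges are the vertex sets $f(V_q)$ of the recorded matches $f$, each with the isomorphism type of its induced subgraph as its topology. Then, for every filtering, spanning tree (forest), stopping rule and $n$: 1. If $f\in\mathcal M$, then $W>0$ and one trial records $f$ with probability exactly $1/W$. 2. The recorded matches are uniformly sampled from all matches: all of them lie in $\mathcal M$, and, given that there are $k$ of them, they are distributed as $k$ independent uniform elements of $\mathcal M$; i.e. each list in $\mathcal M^k$ occurs with probability $\Pr(k\text{ matches are recorded})\cdot|\mathcal M|^{-k}$. 3. Suppose that the property constraints of $q$ (if there are any) are invariant under the automorphisms of the labelled graph $q$. Then the hyperedges are uniformly sampled from all induced subgraphs of $G$ isomorphic to $q$: the vertex sets of the recorded matches, listed with repetitions, lie in $\mathcal E$ and, given their number $k$, are distributed as $k$ independent uniform elements of $\mathcal E$; and the set of hyperedges of the output is a subset of $\mathcal E$ which, given its cardinality $m$, is uniformly distributed on the $m$-element subsets of $\mathcal E$. 4. If at least one trial is made, then each element of $\mathcal E$ is a hyperedge of the output with positive probability. -/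

import Mathlib

open scoped ENNReal

noncomputable section

namespace ExBI

/-! ### Property graphs, query graphs and induced matchings -/

/-- A property graph with vertex set `V`, labels in `L` and property names `P`, the property `p`
having values in `D p`. Edges are unordered pairs. The label and the properties of an unordered
pair that is not an edge are never used. -/
structure PropertyGraph (V L : Type*) (P : Type*) (D : P → Type*) where
  edges : Set (Sym2 V)
  vertexLabel : V → L
  edgeLabel : Sym2 V → L
  vertexProp : V → (p : P) → D p
  edgeProp : Sym2 V → (p : P) → D p

/-- A query graph with vertex set `Vq`: edges, labels, and (optional) constraints on the property
values of the data vertices and data edges that query vertices and query edges are mapped to.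
A query without constraints has `vertexOk` and `edgeOk` constantly `True`. -/
structure QueryGraph (Vq L : Type*) (P : Type*) (D : P → Type*) where
  edges : Set (Sym2 Vq)
  vertexLabel : Vq → L
  edgeLabel : Sym2 Vq → L
  vertexOk : Vq → ((p : P) → D p) → Prop
  edgeOk : Sym2 Vq → ((p : P) → D p) → Prop

section

variable {Vq V L P : Type*} {D : P → Type*}

/-- The edge set of the subgraph of `G` induced by the vertex set `S`. -/
def PropertyGraph.inducedEdges (G : PropertyGraph V L P D) (S : Finset V) : Set (Sym2 V) :=
  {e | e ∈ G.edges ∧ ∀ x ∈ e, x ∈ S}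

/-- `f` is a matching of the query `q` onto the subgraph of `G` induced by `S`
(induced subgraph isomorphism that also satisfies the property constraints of `q`). -/
structure IsMatching (G : PropertyGraph V L P D) (q : QueryGraph Vq L P D)
    (S : Finset V) (f : Vq → V) : Prop where
  bijOn : Set.BijOn f Set.univ (S : Set V)
  vertexLabel : ∀ u, q.vertexLabel u = G.vertexLabel (f u)
  edge : ∀ u₁ u₂, s(u₁, u₂) ∈ q.edges →
    s(f u₁, f u₂) ∈ G.inducedEdges S ∧ q.edgeLabel s(u₁, u₂) = G.edgeLabel s(f u₁, f u₂)
  induced : ∀ u₁ u₂, s(f u₁, f u₂) ∈ G.inducedEdges S →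
    s(u₁, u₂) ∈ q.edges ∧ G.edgeLabel s(f u₁, f u₂) = q.edgeLabel s(u₁, u₂)
  vertexOk : ∀ u, q.vertexOk u (G.vertexProp (f u))
  edgeOk : ∀ u₁ u₂, s(u₁, u₂) ∈ q.edges → q.edgeOk s(u₁, u₂) (G.edgeProp s(f u₁, f u₂))

/-- `f` is a match of `q` in `G`: a matching onto some induced subgraph of `G`. -/
def IsMatch (G : PropertyGraph V L P D) (q : QueryGraph Vq L P D) (f : Vq → V) : Prop :=
  ∃ S : Finset V, IsMatching G q S f

/-- The set of all matches of `q` in `G`. -/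
def allMatches [Finite Vq] [Finite V] (G : PropertyGraph V L P D) (q : QueryGraph Vq L P D) :
    Finset (Vq → V) :=
  (Set.toFinite {f | IsMatch G q f}).toFinset

/-- Automorphisms of the labelled graph underlying `q`. -/
structure IsAutomorphism (q : QueryGraph Vq L P D) (σ : Equiv.Perm Vq) : Prop where
  vertexLabel : ∀ u, q.vertexLabel (σ u) = q.vertexLabel u
  edge : ∀ u₁ u₂, s(σ u₁, σ u₂) ∈ q.edges ↔ s(u₁, u₂) ∈ q.edges
  edgeLabel : ∀ u₁ u₂, s(u₁, u₂) ∈ q.edges →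
    q.edgeLabel s(σ u₁, σ u₂) = q.edgeLabel s(u₁, u₂)

/-- The property constraints of `q` treat query vertices and query edges alike that are exchanged
by an automorphism of `q`. This holds in particular if `q` has no constraints. -/
def QueryGraph.SymmetricConstraints (q : QueryGraph Vq L P D) : Prop :=
  ∀ σ : Equiv.Perm Vq, IsAutomorphism q σ →
    (∀ u, q.vertexOk (σ u) = q.vertexOk u) ∧
    (∀ u₁ u₂, s(u₁, u₂) ∈ q.edges → q.edgeOk s(σ u₁, σ u₂) = q.edgeOk s(u₁, u₂))

/-! ### Hypergraphs over a property graph, and the exact Source operator -/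

/-- Two vertex sets are equivalent if the subgraphs of `G` that they induce are isomorphic as
(unlabelled) graphs. -/
def PropertyGraph.topologySetoid (G : PropertyGraph V L P D) : Setoid (Finset V) where
  r S S' := ∃ e : {x // x ∈ S} ≃ {x // x ∈ S'},
    ∀ x y : {x // x ∈ S}, s(x.1, y.1) ∈ G.edges ↔ s((e x).1, (e y).1) ∈ G.edges
  iseqv :=
    { refl := fun _ => ⟨Equiv.refl _, fun _ _ => Iff.rfl⟩
      symm := fun ⟨e, he⟩ => ⟨e.symm, fun x y => by
        simpa using (he (e.symm x) (e.symm y)).symm⟩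
      trans := fun ⟨e, he⟩ ⟨e', he'⟩ => ⟨e.trans e', fun x y =>
        (he x y).trans (he' (e x) (e y))⟩ }

/-- A hypergraph regarding `G`: its hyperedges are sets of vertices of `G`, each with the built-in
property `topology`. -/
structure Hypergraph (G : PropertyGraph V L P D) where
  hyperedges : Finset (Finset V)
  topology : {ε // ε ∈ hyperedges} → Quotient G.topologySetoid

/-- The hypergraph with a given set of hyperedges, `topology` being the isomorphism type of the
induced subgraph. -/
def Hypergraph.ofHyperedges (G : PropertyGraph V L P D) (E : Finset (Finset V)) :
    Hypergraph G where
  hyperedges := E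
  topology ε := Quotient.mk G.topologySetoid ε.1

/-- The exact Source operator: the hyperedges are the vertex sets of all induced subgraphs of `G`
that are isomorphic to `q`. -/
def source [Finite V] (G : PropertyGraph V L P D) (q : QueryGraph Vq L P D) : Hypergraph G :=
  Hypergraph.ofHyperedges G (Set.toFinite {S | ∃ f, IsMatching G q S f}).toFinset

open Classical in
/-- The vertex set of the data subgraph onto which the query is mapped. -/
def vertexSet [Fintype Vq] (f : Vq → V) : Finset V := Finset.univ.image f

/-! ### The candidate space and its filtering -/

/-- A candidate space: candidate vertices `v ∈ C(u)` for query vertices `u`, and candidate edges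
`(u, v) - (u', v')`. -/
structure CandidateSpace (Vq V : Type*) where
  cand : Vq → V → Prop
  cedge : Vq → V → Vq → V → Prop

namespace CandidateSpace

/-- The initial candidate space: all pairs of vertices and pairs of edges that agree in labels and
satisfy the property constraints. -/
def initial (G : PropertyGraph V L P D) (q : QueryGraph Vq L P D) : CandidateSpace Vq V where
  cand u v := q.vertexLabel u = G.vertexLabel v ∧ q.vertexOk u (G.vertexProp v)
  cedge u v u' v' :=
    (q.vertexLabel u = G.vertexLabel v ∧ q.vertexOk u (G.vertexProp v)) ∧
    (q.vertexLabel u' = G.vertexLabel v' ∧ q.vertexOk u' (G.vertexProp v')) ∧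
    s(u, u') ∈ q.edges ∧ s(v, v') ∈ G.edges ∧
    q.edgeLabel s(u, u') = G.edgeLabel s(v, v') ∧ q.edgeOk s(u, u') (G.edgeProp s(v, v'))

/-- Remove `v` from `C(u)`, together with all candidate edges at `(u, v)`. -/
def removeVertex (cs : CandidateSpace Vq V) (u : Vq) (v : V) : CandidateSpace Vq V where
  cand x a := cs.cand x a ∧ ¬ (x = u ∧ a = v)
  cedge x a y b := cs.cedge x a y b ∧ ¬ (x = u ∧ a = v) ∧ ¬ (y = u ∧ b = v)

/-- Remove the candidate edge `(u, v) - (u', v')`, in both orientations. -/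
def removeEdge (cs : CandidateSpace Vq V) (u : Vq) (v : V) (u' : Vq) (v' : V) :
    CandidateSpace Vq V where
  cand := cs.cand
  cedge x a y b := cs.cedge x a y b ∧
    ¬ (x = u ∧ a = v ∧ y = u' ∧ b = v') ∧ ¬ (x = u' ∧ a = v' ∧ y = u ∧ b = v)

/-- Neighbour label frequency: `v` has at least as many neighbours of each label as `u`. -/
def NeighborSafe (G : PropertyGraph V L P D) (q : QueryGraph Vq L P D) (u : Vq) (v : V) : Prop :=
  ∀ l : L, {u' | s(u, u') ∈ q.edges ∧ q.vertexLabel u' = l}.ncard ≤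
    {v' | s(v, v') ∈ G.edges ∧ G.vertexLabel v' = l}.ncard

/-- Each query edge at `u` has a candidate edge at `(u, v)`. -/
def Supported (q : QueryGraph Vq L P D) (cs : CandidateSpace Vq V) (u : Vq) (v : V) : Prop :=
  ∀ u', s(u, u') ∈ q.edges → ∃ v', cs.cedge u v u' v'

/-- Triangle safety: each triangle of `q` through `u u'` extends the candidate edge to a triangle
of candidate edges. -/
def TriangleSafe (q : QueryGraph Vq L P D) (cs : CandidateSpace Vq V)
    (u : Vq) (v : V) (u' : Vq) (v' : V) : Prop :=
  ∀ x, [u, u', x].Nodup → s(u', x) ∈ q.edges → s(x, u) ∈ q.edges →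
    ∃ a, [v, v', a].Nodup ∧ cs.cedge u' v' x a ∧ cs.cedge x a u v

/-- Four-cycle safety: each four-cycle of `q` through `u u'`, with the chords that are present,
extends the candidate edge to a four-cycle of candidate edges with these chords. -/
def FourCycleSafe (q : QueryGraph Vq L P D) (cs : CandidateSpace Vq V)
    (u : Vq) (v : V) (u' : Vq) (v' : V) : Prop :=
  ∀ x y, [u, u', x, y].Nodup →
    s(u', x) ∈ q.edges → s(x, y) ∈ q.edges → s(y, u) ∈ q.edges →
    ∃ a b, [v, v', a, b].Nodup ∧
      cs.cedge u' v' x a ∧ cs.cedge x a y b ∧ cs.cedge y b u v ∧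
      (s(u, x) ∈ q.edges → cs.cedge u v x a) ∧ (s(u', y) ∈ q.edges → cs.cedge u' v' y b)

/-- Edge bipartite safety: the neighbours of `u` can be assigned distinct candidates along
candidate edges at `(u, v)`, with `v'` assigned to `u'`. -/
def EdgeBipartiteSafe (q : QueryGraph Vq L P D) (cs : CandidateSpace Vq V)
    (u : Vq) (v : V) (u' : Vq) (v' : V) : Prop :=
  ∃ g : Vq → V, Set.InjOn g {x | s(u, x) ∈ q.edges} ∧ g u' = v' ∧
    ∀ x, s(u, x) ∈ q.edges → cs.cedge u v x (g x)

/-- One filtering step: removal of a candidate vertex or candidate edge that violates one of the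
safety conditions. -/
inductive FilterStep (G : PropertyGraph V L P D) (q : QueryGraph Vq L P D) :
    CandidateSpace Vq V → CandidateSpace Vq V → Prop
  | neighbor (cs : CandidateSpace Vq V) (u : Vq) (v : V) (h : ¬ NeighborSafe G q u v) :
      FilterStep G q cs (cs.removeVertex u v)
  | support (cs : CandidateSpace Vq V) (u : Vq) (v : V) (h : ¬ Supported q cs u v) :
      FilterStep G q cs (cs.removeVertex u v)
  | triangle (cs : CandidateSpace Vq V) (u : Vq) (v : V) (u' : Vq) (v' : V)
      (huu : s(u, u') ∈ q.edges) (h : ¬ TriangleSafe q cs u v u' v') :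
      FilterStep G q cs (cs.removeEdge u v u' v')
  | fourCycle (cs : CandidateSpace Vq V) (u : Vq) (v : V) (u' : Vq) (v' : V)
      (huu : s(u, u') ∈ q.edges) (h : ¬ FourCycleSafe q cs u v u' v') :
      FilterStep G q cs (cs.removeEdge u v u' v')
  | bipartite (cs : CandidateSpace Vq V) (u : Vq) (v : V) (u' : Vq) (v' : V)
      (huu : s(u, u') ∈ q.edges) (h : ¬ EdgeBipartiteSafe q cs u v u' v') :
      FilterStep G q cs (cs.removeEdge u v u' v')

/-- `cs` can be the output of the filtering phase: it is obtained from the initial candidate space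
by finitely many filtering steps, in any order and stopped at any time. -/
def IsFiltered (G : PropertyGraph V L P D) (q : QueryGraph Vq L P D)
    (cs : CandidateSpace Vq V) : Prop :=
  Relation.ReflTransGen (FilterStep G q) (initial G q) cs

end CandidateSpace

/-! ### Tree sampling -/

/-- A rooted spanning tree of `q`, or, if `q` is disconnected, a spanning forest with one rooted
tree for each connected component, and an order of visiting the query vertices in which parents
come before their children. -/
structure SpanningForest [DecidableEq Vq] (q : QueryGraph Vq L P D) where
  parent : Vq → Option Vq
  order : List Vq
  nodup : order.Nodup
  mem_order : ∀ u, u ∈ order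
  parent_before : ∀ c u, parent c = some u → order.idxOf u < order.idxOf c
  parent_edge : ∀ c u, parent c = some u → s(u, c) ∈ q.edges
  root_unique : ∀ u u', parent u = none → parent u' = none →
    Relation.ReflTransGen (fun x y => s(x, y) ∈ q.edges) u u' → u = u'

variable [Fintype Vq] [DecidableEq Vq] [Fintype V] {q : QueryGraph Vq L P D}

open Classical in
/-- `treeCount cs T u v` is the number of homomorphisms, along candidate edges, of the subtree of
`T` rooted at `u` that map `u` to `v`, computed bottom-up. -/
def treeCount (cs : CandidateSpace Vq V) (T : SpanningForest q) (u : Vq) (v : V) : ℕ :=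
  ∏ c : {c // T.parent c = some u},
    ∑ w : V, if cs.cedge u v c.1 w then treeCount cs T c.1 w else 0
termination_by T.order.length - T.order.idxOf u
decreasing_by
  have h₁ := T.parent_before c.1 u c.2
  have h₂ := List.idxOf_lt_length_of_mem (T.mem_order c.1)
  omega

open Classical in
/-- The number of homomorphisms of the whole tree (forest) along candidate edges. -/
def treeTotal (cs : CandidateSpace Vq V) (T : SpanningForest q) : ℕ :=
  ∏ r : {r // T.parent r = none}, ∑ v : V, if cs.cand r.1 v then treeCount cs T r.1 v else 0

/-- Draw an element with probability proportional to the weights `w`; fail if all of them are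
zero. -/
def weightedPick (w : V → ℕ) : PMF (Option V) :=
  if h : ∑ v, w v = 0 then PMF.pure none
  else (PMF.ofFintype (fun v => (w v : ℝ≥0∞) / ((∑ x, w x : ℕ) : ℝ≥0∞)) (by
    simp only [div_eq_mul_inv, ← Finset.sum_mul]
    rw [← Nat.cast_sum]
    exact ENNReal.mul_inv_cancel (by exact_mod_cast h) (ENNReal.natCast_ne_top _))).map some

open Classical in
/-- The weights for the choice of the image of `u`, given the images `g` chosen so far. -/
def extensionWeight (cs : CandidateSpace Vq V) (T : SpanningForest q) (g : Vq → Option V)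
    (u : Vq) (v : V) : ℕ :=
  match T.parent u with
  | none => if cs.cand u v then treeCount cs T u v else 0
  | some p =>
    match g p with
    | none => 0
    | some w => if cs.cedge p w u v then treeCount cs T u v else 0

/-- Choose the images of the listed query vertices one after the other (`none` after a failure). -/
def sampleTree (cs : CandidateSpace Vq V) (T : SpanningForest q) :
    List Vq → (Vq → Option V) → PMF (Vq → Option V)
  | [], g => PMF.pure g
  | u :: l, g => (weightedPick (extensionWeight cs T g u)).bind fun o =>
      sampleTree cs T l (Function.update g u o)

open Classical in
/-- The match recorded for a sampled tree: the sampled map if it is total and an induced match of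
`q` in `G`, and nothing otherwise. -/
def acceptMatch (G : PropertyGraph V L P D) (q : QueryGraph Vq L P D) (g : Vq → Option V) :
    Option (Vq → V) :=
  if h : ∃ f : Vq → V, (∀ u, g u = some (f u)) ∧ IsMatch G q f then some h.choose else none

/-- One trial of tree sampling. -/
def treeTrial (G : PropertyGraph V L P D) (cs : CandidateSpace Vq V) (T : SpanningForest q) :
    PMF (Option (Vq → V)) :=
  (sampleTree cs T T.order (fun _ => none)).map (acceptMatch G q)

/-- Independent repetition of `trial`, at most `n` times, recording the successful outcomes in the
order of their occurrence. Before each trial, the rule `halt` decides from the history of successes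
and failures (latest first) whether to end the run. -/
def repeatTrials {α : Type*} (trial : PMF (Option α)) (halt : List Bool → Bool) :
    ℕ → List Bool → PMF (List α)
  | 0, _ => PMF.pure []
  | n + 1, h =>
      if halt h then PMF.pure []
      else trial.bind fun o =>
        (repeatTrials trial halt n (o.isSome :: h)).map fun l => o.toList ++ l

/-- The list of matches recorded by a run of the sampling Source operator. -/
def sampledMatches (G : PropertyGraph V L P D) (cs : CandidateSpace Vq V) (T : SpanningForest q)
    (halt : List Bool → Bool) (n : ℕ) : PMF (List (Vq → V)) :=
  repeatTrials (treeTrial G cs T) halt n []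

open Classical in
/-- The sampling Source operator: the random hypergraph whose hyperedges are the vertex sets of the
recorded matches. -/
def sourceFas (G : PropertyGraph V L P D) (cs : CandidateSpace Vq V) (T : SpanningForest q)
    (halt : List Bool → Bool) (n : ℕ) : PMF (Hypergraph G) :=
  (sampledMatches G cs T halt n).map fun l =>
    Hypergraph.ofHyperedges G (l.map vertexSet).toFinset

end

/-! ### Uniform samples -/

/-- The random list is a uniform sample (with replacement) from `S`: its entries lie in `S`, and,
given its length, they are independent and uniformly distributed on `S`. -/
def IsUniformListSample {α : Type*} (S : Finset α) (X : PMF (List α)) : Prop :=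
  (∀ l ∈ X.support, ∀ x ∈ l, x ∈ S) ∧
  ∀ l : List α, (∀ x ∈ l, x ∈ S) →
    X l = X.map List.length l.length * ((S.card : ℝ≥0∞)⁻¹) ^ l.length

/-- The random finite set is a uniform sample (without replacement) from `S`: it is contained in
`S`, and, given its cardinality `m`, it is uniformly distributed on the subsets of `S` with `m`
elements. -/
def IsUniformSetSample {α : Type*} (S : Finset α) (X : PMF (Finset α)) : Prop :=
  (∀ E ∈ X.support, E ⊆ S) ∧
  ∀ E : Finset α, E ⊆ S →
    X E = X.map Finset.card E.card * ((S.card.choose E.card : ℕ) : ℝ≥0∞)⁻¹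

end ExBI

end

/-! Every safety condition of the filtering is necessary for a match: a match itself supplies the
neighbours, triangles, four-cycles and assignments asked for. Hence no vertex or edge used by a
match is ever removed (`CandidateSpace.IsFiltered.carries`).

For a map `f` along surviving candidates, a trial yields `f` with probability `∏ u, D(u, f u) / Z
u`, where `Z u` is the total weight at the choice for `u`. Grouped by parent, the `Z c` of the
children of `p` multiply to `D(p, f p)` and those of the roots to `W`, so everything cancels except
`1/W` (`prod_sum_extensionWeight`, `CandidateSpace.Carries.sampleTree_order`). The final test
discards all non-matches, so a successful trial is uniform on the matches.

The halting rule sees only success bits, which carry no information on the recorded values;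
induction on the number of trials gives uniform lists (`isUniformListSample_repeatTrials`). The same
lemma serves for vertex sets: automorphisms of the query act simply transitively on the matchings
onto a fixed set, so each set is hit with probability `|Aut q| / W`. Passing from lists to sets uses
the symmetry of a uniform sample under permutations (`IsUniformListSample.map_toFinset_congr`). -/

namespace ExBI

/-! ### Matchings onto a fixed vertex set and automorphisms of the query. -/

section Matching

variable {Vq V L P : Type*} {D : P → Type*} {G : PropertyGraph V L P D} {q : QueryGraph Vq L P D}
  {S : Finset V} {f : Vq → V}

theorem IsMatching.injective (h : IsMatching G q S f) : Function.Injective f :=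
  Set.injOn_univ.1 h.bijOn.injOn

theorem IsMatching.mem (h : IsMatching G q S f) (u : Vq) : f u ∈ S :=
  Finset.mem_coe.1 (h.bijOn.mapsTo (Set.mem_univ u))

theorem IsMatching.mem_edges_iff (h : IsMatching G q S f) (u₁ u₂ : Vq) :
    s(f u₁, f u₂) ∈ G.edges ↔ s(u₁, u₂) ∈ q.edges := by
  refine ⟨fun he => (h.induced u₁ u₂ ⟨he, ?_⟩).1, fun he => (h.edge u₁ u₂ he).1.1⟩
  intro x hx
  rcases Sym2.mem_iff.1 hx with rfl | rfl <;> exact h.mem _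

theorem IsMatching.vertexSet_eq [Fintype Vq] (h : IsMatching G q S f) : vertexSet f = S := by
  classical
  apply Finset.coe_injective
  simpa [vertexSet] using h.bijOn.image_eq

theorem isMatching_iff_isMatch [Fintype Vq] :
    IsMatching G q S f ↔ IsMatch G q f ∧ vertexSet f = S :=
  ⟨fun h => ⟨⟨S, h⟩, h.vertexSet_eq⟩, fun ⟨⟨S', h'⟩, h⟩ => by rwa [← h, h'.vertexSet_eq]⟩

theorem mem_allMatches [Finite Vq] [Finite V] : f ∈ allMatches G q ↔ IsMatch G q f := by
  simp [allMatches]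

theorem mem_source_hyperedges [Finite V] :
    S ∈ (source G q).hyperedges ↔ ∃ f, IsMatching G q S f := by
  simp [source, Hypergraph.ofHyperedges]

theorem IsMatching.comp_automorphism (hq : q.SymmetricConstraints) (h : IsMatching G q S f)
    {σ : Equiv.Perm Vq} (hσ : IsAutomorphism q σ) : IsMatching G q S (f ∘ σ) where
  bijOn := h.bijOn.comp (by simpa [Set.bijOn_univ] using σ.bijective)
  vertexLabel u := by rw [← hσ.vertexLabel u]; exact h.vertexLabel _
  edge u₁ u₂ he := by
    rw [← hσ.edgeLabel u₁ u₂ he]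
    exact h.edge _ _ ((hσ.edge u₁ u₂).2 he)
  induced u₁ u₂ he := by
    obtain ⟨h₁, h₂⟩ := h.induced _ _ he
    have h₃ := (hσ.edge u₁ u₂).1 h₁
    exact ⟨h₃, by rw [← hσ.edgeLabel u₁ u₂ h₃]; exact h₂⟩
  vertexOk u := by rw [← (hq σ hσ).1 u]; exact h.vertexOk _
  edgeOk u₁ u₂ he := by
    rw [← (hq σ hσ).2 u₁ u₂ he]
    exact h.edgeOk _ _ ((hσ.edge u₁ u₂).2 he)

/-- The automorphism is `f⁻¹ ∘ f'`, defined because both maps are bijections onto `S`. It preserves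
edges in both directions since both matchings are induced. -/
theorem IsMatching.exists_automorphism {f' : Vq → V} (h : IsMatching G q S f)
    (h' : IsMatching G q S f') : ∃ σ, IsAutomorphism q σ ∧ f ∘ σ = f' := by
  have hr : ∀ u, ∃ w, f w = f' u := fun u => by
    obtain ⟨w, -, hw⟩ := h.bijOn.surjOn (h'.bijOn.mapsTo (Set.mem_univ u))
    exact ⟨w, hw⟩
  choose s hs using hr
  have hbij : Function.Bijective s := by
    constructor
    · intro a b hab
      apply h'.injective
      rw [← hs, ← hs, hab]
    · intro w
      obtain ⟨u, -, hu⟩ := h'.bijOn.surjOn (h.bijOn.mapsTo (Set.mem_univ w))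
      exact ⟨u, h.injective (by rw [hs, hu])⟩
  refine ⟨Equiv.ofBijective s hbij, ⟨fun u => ?_, fun u₁ u₂ => ?_, fun u₁ u₂ he => ?_⟩,
    funext hs⟩
  · simp only [Equiv.ofBijective_apply]
    rw [h.vertexLabel, h'.vertexLabel, hs]
  · simp only [Equiv.ofBijective_apply]
    rw [← h.mem_edges_iff, ← h'.mem_edges_iff, hs, hs]
  · simp only [Equiv.ofBijective_apply]
    have he' : s(s u₁, s u₂) ∈ q.edges := by
      rwa [← h.mem_edges_iff, hs, hs, h'.mem_edges_iff]
    rw [(h.edge _ _ he').2, (h'.edge _ _ he).2, hs, hs]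

/-- The matchings onto a fixed induced subgraph are as many as the automorphisms of the query. -/
theorem IsMatching.card_isMatching_eq (hq : q.SymmetricConstraints) (h : IsMatching G q S f) :
    Nat.card {f' // IsMatching G q S f'} = Nat.card {σ // IsAutomorphism q σ} := by
  -- The action by precomposition is free because `f` is injective, and transitive by
  -- `exists_automorphism`.
  refine (Nat.card_congr (Equiv.ofBijective
    (fun σ : {σ // IsAutomorphism q σ} =>
      (⟨f ∘ σ.1, h.comp_automorphism hq σ.2⟩ : {f' // IsMatching G q S f'})) ⟨?_, ?_⟩)).symm
  · intro σ σ' he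
    ext u
    exact h.injective (congrFun (congrArg Subtype.val he) u)
  · rintro ⟨f', h'⟩
    obtain ⟨σ, hσ, he⟩ := h.exists_automorphism h'
    exact ⟨⟨σ, hσ⟩, Subtype.ext he⟩

end Matching

/-! ### Soundness of the filtering. -/

namespace CandidateSpace

variable {Vq V L P : Type*} {D : P → Type*} {G : PropertyGraph V L P D} {q : QueryGraph Vq L P D}
  {cs cs' : CandidateSpace Vq V} {f : Vq → V}

/-- The map `f` runs along candidate vertices and candidate edges. -/
structure Carries (cs : CandidateSpace Vq V) (q : QueryGraph Vq L P D) (f : Vq → V) : Prop where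
  cand : ∀ u, cs.cand u (f u)
  cedge : ∀ u u', s(u, u') ∈ q.edges → cs.cedge u (f u) u' (f u')

theorem carries_initial (hf : IsMatch G q f) : (initial G q).Carries q f := by
  obtain ⟨S, h⟩ := hf
  have hc : ∀ u, (initial G q).cand u (f u) := fun u => ⟨h.vertexLabel u, h.vertexOk u⟩
  exact ⟨hc, fun u u' he =>
    ⟨hc u, hc u', he, (h.mem_edges_iff _ _).2 he, (h.edge _ _ he).2, h.edgeOk _ _ he⟩⟩

theorem Carries.removeVertex (h : cs.Carries q f) {u : Vq} {v : V} (hv : f u ≠ v) :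
    (cs.removeVertex u v).Carries q f := by
  have hne : ∀ x, ¬ (x = u ∧ f x = v) := by rintro x ⟨rfl, hx⟩; exact hv hx
  exact ⟨fun x => ⟨h.cand x, hne x⟩, fun x y he => ⟨h.cedge x y he, hne x, hne y⟩⟩

theorem Carries.removeEdge (h : cs.Carries q f) {u u' : Vq} {v v' : V}
    (hv : ¬ (f u = v ∧ f u' = v')) : (cs.removeEdge u v u' v').Carries q f := by
  refine ⟨h.cand, fun x y he => ⟨h.cedge x y he, ?_, ?_⟩⟩
  · rintro ⟨rfl, hx, rfl, hy⟩; exact hv ⟨hx, hy⟩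
  · rintro ⟨rfl, hx, rfl, hy⟩; exact hv ⟨hy, hx⟩

theorem neighborSafe_of_isMatch [Finite V] (hf : IsMatch G q f) (u : Vq) :
    NeighborSafe G q u (f u) := by
  obtain ⟨S, h⟩ := hf
  intro l
  refine Set.ncard_le_ncard_of_injOn f ?_ h.injective.injOn (Set.toFinite _)
  rintro u' ⟨he, hl⟩
  exact ⟨(h.mem_edges_iff _ _).2 he, by rw [← h.vertexLabel, hl]⟩

theorem Carries.triangleSafe (h : cs.Carries q f) (hf : Function.Injective f) (u u' : Vq) :
    TriangleSafe q cs u (f u) u' (f u') := fun x hx h₁ h₂ =>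
  ⟨f x, by simpa using hx.map hf, h.cedge _ _ h₁, h.cedge _ _ h₂⟩

theorem Carries.fourCycleSafe (h : cs.Carries q f) (hf : Function.Injective f) (u u' : Vq) :
    FourCycleSafe q cs u (f u) u' (f u') := fun x y hx h₁ h₂ h₃ =>
  ⟨f x, f y, by simpa only [List.map_cons, List.map_nil] using hx.map hf, h.cedge _ _ h₁,
    h.cedge _ _ h₂, h.cedge _ _ h₃, h.cedge _ _, h.cedge _ _⟩

theorem Carries.edgeBipartiteSafe (h : cs.Carries q f) (hf : Function.Injective f) (u u' : Vq) :
    EdgeBipartiteSafe q cs u (f u) u' (f u') :=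
  ⟨f, hf.injOn, rfl, fun _ => h.cedge _ _⟩

/-- If the removed vertex or edge lay on `f`, then `f` would witness the very safety condition whose
failure justified the removal. -/
theorem FilterStep.carries [Finite V] (hf : IsMatch G q f) (hs : FilterStep G q cs cs')
    (h : cs.Carries q f) : cs'.Carries q f := by
  have hinj : Function.Injective f := hf.choose_spec.injective
  cases hs with
  | neighbor u v hn =>
    exact h.removeVertex (by rintro rfl; exact hn (neighborSafe_of_isMatch hf u))
  | support u v hn =>
    exact h.removeVertex (by rintro rfl; exact hn fun u' he => ⟨f u', h.cedge _ _ he⟩)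
  | triangle u v u' v' _ hn =>
    exact h.removeEdge (by rintro ⟨rfl, rfl⟩; exact hn (h.triangleSafe hinj u u'))
  | fourCycle u v u' v' _ hn =>
    exact h.removeEdge (by rintro ⟨rfl, rfl⟩; exact hn (h.fourCycleSafe hinj u u'))
  | bipartite u v u' v' _ hn =>
    exact h.removeEdge (by rintro ⟨rfl, rfl⟩; exact hn (h.edgeBipartiteSafe hinj u u'))

/-- Filtering never loses a match. -/
theorem IsFiltered.carries [Finite V] (hcs : IsFiltered G q cs) (hf : IsMatch G q f) :
    cs.Carries q f := by
  induction hcs with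
  | refl => exact carries_initial hf
  | tail _ hs ih => exact hs.carries hf ih

end CandidateSpace

/-! ### Probability of a map in one trial of tree sampling. -/

theorem SpanningForest.order_pairwise {Vq L P : Type*} {D : P → Type*} [DecidableEq Vq]
    {q : QueryGraph Vq L P D} (T : SpanningForest q) :
    T.order.Pairwise fun a b => T.parent a ≠ some b := by
  rw [List.pairwise_iff_getElem]
  intro i j hi hj hij he
  have := T.parent_before _ _ he
  rw [T.nodup.idxOf_getElem, T.nodup.idxOf_getElem] at this
  omega

section TreeSampling

variable {Vq V L P : Type*} {D : P → Type*} [Fintype Vq] [DecidableEq Vq] [Fintype V]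
  {G : PropertyGraph V L P D} {q : QueryGraph Vq L P D} {cs : CandidateSpace Vq V}
  {f : Vq → V}

theorem weightedPick_some (w : V → ℕ) (v : V) :
    weightedPick w (some v) = (w v : ℝ≥0∞) / ((∑ x, w x : ℕ) : ℝ≥0∞) := by
  unfold weightedPick
  split_ifs with h
  -- The formula survives failure: the quotient is `0 / 0`, which is `0` in `ℝ≥0∞`.
  · have hv : w v = 0 := Finset.sum_eq_zero_iff.1 h v (Finset.mem_univ v)
    simp [hv]
  · rw [PMF.map_apply, tsum_eq_single v]
    · simp
    · intro x hx
      simp [hx.symm]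

theorem extensionWeight_congr (cs : CandidateSpace Vq V) (T : SpanningForest q)
    {g g' : Vq → Option V} {u : Vq} (h : ∀ p, T.parent u = some p → g p = g' p) :
    extensionWeight cs T g u = extensionWeight cs T g' u := by
  funext v
  unfold extensionWeight
  cases hp : T.parent u with
  | none => rfl
  | some p => simp only [h p hp]

/-- A vertex outside the remaining list is never assigned again, so a disagreement with the target
is permanent. -/
theorem sampleTree_eq_zero (cs : CandidateSpace Vq V) (T : SpanningForest q) {t : Vq → Option V}
    {u : Vq} (l : List Vq) (g : Vq → Option V) (hu : u ∉ l) (hg : g u ≠ t u) :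
    sampleTree cs T l g t = 0 := by
  induction l generalizing g with
  | nil =>
    have : t ≠ g := by rintro rfl; exact hg rfl
    simp [sampleTree, this]
  | cons a l ih =>
    rw [List.mem_cons, not_or] at hu
    rw [sampleTree, PMF.bind_apply]
    refine ENNReal.tsum_eq_zero.2 fun o => ?_
    rw [ih _ hu.2 (by rwa [Function.update_of_ne hu.1]), mul_zero]

/-- Only one sequence of choices leads to `f`, so the sum over outcomes is a single product. The
weights can be computed from the complete map `f`, because they depend only on the image of the
parent, which is already fixed. -/
theorem sampleTree_apply (cs : CandidateSpace Vq V) (T : SpanningForest q) (f : Vq → V)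
    (l : List Vq) (g : Vq → Option V) (hl : l.Nodup)
    (hp : l.Pairwise fun a b => T.parent a ≠ some b) (hg : ∀ u, u ∉ l → g u = some (f u)) :
    sampleTree cs T l g (fun u => some (f u)) =
      (l.map fun u => weightedPick (extensionWeight cs T (fun u => some (f u)) u)
        (some (f u))).prod := by
  induction l generalizing g with
  | nil =>
    have : g = fun u => some (f u) := funext fun u => hg u (by simp)
    simp [sampleTree, this]
  | cons a l ih =>
    rw [List.nodup_cons] at hl
    rw [List.pairwise_cons] at hp
    have hw : extensionWeight cs T g a = extensionWeight cs T (fun u => some (f u)) a := by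
      refine extensionWeight_congr cs T fun p h => hg p ?_
      rw [List.mem_cons, not_or]
      refine ⟨?_, fun hpl => hp.1 p hpl h⟩
      rintro rfl
      exact lt_irrefl _ (T.parent_before _ _ h)
    rw [sampleTree, PMF.bind_apply, tsum_eq_single (some (f a)), hw, List.map_cons, List.prod_cons,
      ih _ hl.2 hp.2]
    · intro u hu
      by_cases h : u = a
      · subst h; simp
      · rw [Function.update_of_ne h]
        exact hg u (by simp [h, hu])
    · intro o ho
      rw [sampleTree_eq_zero cs T l _ hl.1 (by simpa using ho), mul_zero]

theorem extensionWeight_root (cs : CandidateSpace Vq V) (T : SpanningForest q)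
    (g : Vq → Option V) {u : Vq} (h : T.parent u = none) (v : V) [Decidable (cs.cand u v)] :
    extensionWeight cs T g u v = if cs.cand u v then treeCount cs T u v else 0 := by
  unfold extensionWeight
  simp only [h]
  congr

theorem extensionWeight_child (cs : CandidateSpace Vq V) (T : SpanningForest q)
    (f : Vq → V) {u p : Vq} (h : T.parent u = some p) (v : V) [Decidable (cs.cedge p (f p) u v)] :
    extensionWeight cs T (fun u => some (f u)) u v =
      if cs.cedge p (f p) u v then treeCount cs T u v else 0 := by
  unfold extensionWeight
  simp only [h]
  congr

theorem CandidateSpace.Carries.extensionWeight_eq (h : cs.Carries q f) (T : SpanningForest q)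
    (u : Vq) : extensionWeight cs T (fun u => some (f u)) u (f u) = treeCount cs T u (f u) := by
  classical
  cases hp : T.parent u with
  | none => rw [extensionWeight_root cs T _ hp, if_pos (h.cand u)]
  | some p =>
    rw [extensionWeight_child cs T f hp, if_pos (h.cedge _ _ (T.parent_edge _ _ hp))]

theorem treeCount_eq_prod_extensionWeight (cs : CandidateSpace Vq V) (T : SpanningForest q)
    (f : Vq → V) (u : Vq) :
    treeCount cs T u (f u) = ∏ c : {c // T.parent c = some u},
      ∑ w, extensionWeight cs T (fun u => some (f u)) c.1 w := by
  classical
  rw [treeCount]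
  refine Finset.prod_congr rfl fun c _ => Finset.sum_congr rfl fun w _ => ?_
  rw [extensionWeight_child cs T f c.2]

theorem treeTotal_eq_prod_extensionWeight (cs : CandidateSpace Vq V) (T : SpanningForest q)
    (g : Vq → Option V) :
    treeTotal cs T = ∏ r : {r // T.parent r = none}, ∑ v, extensionWeight cs T g r.1 v := by
  classical
  rw [treeTotal]
  refine Finset.prod_congr rfl fun r _ => Finset.sum_congr rfl fun v _ => ?_
  rw [extensionWeight_root cs T _ r.2]

/-- The product of all denominators, split along the fibres of `T.parent`: the fibre over `none`
gives `treeTotal`, the fibre over `some u` gives the recursion for `treeCount` at `u`. -/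
theorem prod_sum_extensionWeight (cs : CandidateSpace Vq V) (T : SpanningForest q) (f : Vq → V) :
    ∏ u, ∑ v, extensionWeight cs T (fun u => some (f u)) u v =
      treeTotal cs T * ∏ u, treeCount cs T u (f u) := by
  rw [← Fintype.prod_fiberwise T.parent, Fintype.prod_option,
    treeTotal_eq_prod_extensionWeight cs T fun u => some (f u)]
  congr 1
  exact Finset.prod_congr rfl fun u _ => (treeCount_eq_prod_extensionWeight cs T f u).symm

/-- In the sum for each child `c`, the summand at `f c` is positive, by recursion down the tree. -/
theorem CandidateSpace.Carries.treeCount_pos (h : cs.Carries q f) (T : SpanningForest q) (u : Vq) :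
    0 < treeCount cs T u (f u) := by
  rw [treeCount_eq_prod_extensionWeight]
  refine Finset.prod_pos fun c _ => ?_
  refine lt_of_lt_of_le ?_
    (Finset.single_le_sum (fun _ _ => Nat.zero_le _) (Finset.mem_univ (f c.1)))
  rw [h.extensionWeight_eq]
  exact h.treeCount_pos T c.1
termination_by T.order.length - T.order.idxOf u
decreasing_by
  have h₁ := T.parent_before c.1 u c.2
  have h₂ := List.idxOf_lt_length_of_mem (T.mem_order c.1)
  omega

theorem CandidateSpace.Carries.sum_extensionWeight_pos (h : cs.Carries q f) (T : SpanningForest q)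
    (u : Vq) : 0 < ∑ v, extensionWeight cs T (fun u => some (f u)) u v := by
  refine lt_of_lt_of_le ?_
    (Finset.single_le_sum (fun _ _ => Nat.zero_le _) (Finset.mem_univ (f u)))
  rw [h.extensionWeight_eq]
  exact h.treeCount_pos T u

theorem CandidateSpace.Carries.treeTotal_pos (h : cs.Carries q f) (T : SpanningForest q) :
    0 < treeTotal cs T := by
  rw [treeTotal_eq_prod_extensionWeight cs T fun u => some (f u)]
  exact Finset.prod_pos fun r _ => h.sum_extensionWeight_pos T r.1

/-- Each map along candidate edges is sampled with the same probability. -/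
theorem CandidateSpace.Carries.sampleTree_order (h : cs.Carries q f) (T : SpanningForest q) :
    sampleTree cs T T.order (fun _ => none) (fun u => some (f u)) =
      (treeTotal cs T : ℝ≥0∞)⁻¹ := by
  rw [sampleTree_apply cs T f T.order _ T.nodup T.order_pairwise
    fun u hu => absurd (T.mem_order u) hu]
  have huniv : T.order.toFinset = Finset.univ := by ext u; simp [T.mem_order u]
  rw [← List.prod_toFinset _ T.nodup, huniv]
  have hnum : ((∏ u, treeCount cs T u (f u) : ℕ) : ℝ≥0∞) ≠ 0 :=
    Nat.cast_ne_zero.2 (Finset.prod_pos fun u _ => h.treeCount_pos T u).ne'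
  have htot : (treeTotal cs T : ℝ≥0∞) ≠ 0 := Nat.cast_ne_zero.2 (h.treeTotal_pos T).ne'
  simp only [weightedPick_some, h.extensionWeight_eq, div_eq_mul_inv, Finset.prod_mul_distrib]
  rw [← ENNReal.prod_inv_distrib, ← Nat.cast_prod, ← Nat.cast_prod, prod_sum_extensionWeight,
    Nat.cast_mul, ENNReal.mul_inv (Or.inl htot) (Or.inr hnum), mul_left_comm,
    ENNReal.mul_inv_cancel hnum (ENNReal.natCast_ne_top _), mul_one]
  -- Side condition of `ENNReal.prod_inv_distrib`: the factors are finite.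
  intro u _ v _ _
  exact Or.inr (ENNReal.natCast_ne_top _)

/-- The choice in `acceptMatch` is harmless, since a total `g` determines `f`. -/
theorem acceptMatch_eq_some_iff (g : Vq → Option V) :
    acceptMatch G q g = some f ↔ g = (fun u => some (f u)) ∧ IsMatch G q f := by
  unfold acceptMatch
  constructor
  · intro h
    split_ifs at h with hex
    obtain rfl := Option.some.inj h
    exact ⟨funext hex.choose_spec.1, hex.choose_spec.2⟩
  · rintro ⟨rfl, hf⟩
    have hex : ∃ f' : Vq → V, (∀ u, (fun u => some (f u)) u = some (f' u)) ∧ IsMatch G q f' :=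
      ⟨f, fun _ => rfl, hf⟩
    rw [dif_pos hex]
    congr 1
    funext u
    exact (Option.some.inj (hex.choose_spec.1 u)).symm

theorem treeTrial_some (hcs : CandidateSpace.IsFiltered G q cs) (T : SpanningForest q)
    (hf : IsMatch G q f) : treeTrial G cs T (some f) = (treeTotal cs T : ℝ≥0∞)⁻¹ := by
  rw [← (hcs.carries hf).sampleTree_order T, treeTrial, PMF.map_apply,
    tsum_eq_single fun u => some (f u)]
  · rw [if_pos ((acceptMatch_eq_some_iff _).2 ⟨rfl, hf⟩).symm]
  · intro g hg
    rw [if_neg fun h => hg ((acceptMatch_eq_some_iff g).1 h.symm).1]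

theorem treeTrial_some_of_not_isMatch (cs : CandidateSpace Vq V) (T : SpanningForest q)
    (hf : ¬ IsMatch G q f) : treeTrial G cs T (some f) = 0 := by
  rw [treeTrial, PMF.map_apply]
  refine ENNReal.tsum_eq_zero.2 fun g => ?_
  rw [if_neg fun h => hf ((acceptMatch_eq_some_iff g).1 h.symm).2]

end TreeSampling

end ExBI

namespace ExBI

theorem tsum_option_ennreal {α : Type*} (f : Option α → ℝ≥0∞) :
    ∑' o, f o = f none + ∑' a, f (some a) := by
  rw [← (Equiv.optionEquivSumPUnit.{0} α).symm.tsum_eq,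
    ENNReal.summable.tsum_sum ENNReal.summable, add_comm]
  simp

/-! ### Repeated trials with a halting rule. -/

section Repetition

variable {α β : Type*} {trial : PMF (Option α)} {halt : List Bool → Bool} {S : Finset α}

theorem repeatTrials_of_halt {h : List Bool} (hh : halt h = true) (n : ℕ) :
    repeatTrials trial halt n h = PMF.pure [] := by
  cases n <;> simp [repeatTrials, hh]

theorem repeatTrials_succ {h : List Bool} (hh : halt h = false) (n : ℕ) :
    repeatTrials trial halt (n + 1) h = trial.bind fun o =>
      (repeatTrials trial halt n (o.isSome :: h)).map fun l => o.toList ++ l := by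
  simp [repeatTrials, hh]

/-- `Option.map` preserves success and failure, which is all that `halt` sees. The vertex sets of
recorded matches thus come from repeated trials themselves. -/
theorem repeatTrials_map (trial : PMF (Option α)) (halt : List Bool → Bool) (φ : α → β) (n : ℕ)
    (h : List Bool) : (repeatTrials trial halt n h).map (List.map φ) =
      repeatTrials (trial.map (Option.map φ)) halt n h := by
  induction n generalizing h with
  | zero => simp [repeatTrials, PMF.pure_map]
  | succ n ih =>
    cases hh : halt h with
    | true => rw [repeatTrials_of_halt hh, repeatTrials_of_halt hh, PMF.pure_map, List.map_nil]
    | false =>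
      rw [repeatTrials_succ hh, repeatTrials_succ hh, PMF.map_bind, PMF.bind_map]
      congr 1
      funext o
      simp only [Function.comp_apply, Option.isSome_map, ← ih, PMF.map_comp]
      congr 1
      funext l
      cases o <;> simp

/-- Conditioning on the first trial: it fails, or it produces the head `a`. -/
theorem repeatTrials_cons {h : List Bool} (hh : halt h = false) (n : ℕ) (a : α) (l : List α) :
    repeatTrials trial halt (n + 1) h (a :: l) =
      trial none * repeatTrials trial halt n (false :: h) (a :: l) +
        trial (some a) * repeatTrials trial halt n (true :: h) l := by
  classical
  have hne : ∀ b, b ≠ a → trial (some b) *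
      ((repeatTrials trial halt n (true :: h)).map fun l => b :: l) (a :: l) = 0 := by
    intro b hb
    rw [PMF.map_apply, ENNReal.tsum_eq_zero.2, mul_zero]
    intro l'
    rw [if_neg]
    intro he
    exact hb (List.cons.inj he).1.symm
  have heq : ((repeatTrials trial halt n (true :: h)).map fun l => a :: l) (a :: l) =
      repeatTrials trial halt n (true :: h) l := by
    rw [PMF.map_apply, tsum_eq_single l, if_pos rfl]
    intro l' hl
    rw [if_neg]
    intro he
    exact hl (List.cons.inj he).2.symm
  rw [repeatTrials_succ hh, PMF.bind_apply, tsum_option_ennreal]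
  simp only [Option.isSome_none, Option.isSome_some, Option.toList_none, Option.toList_some,
    List.nil_append, List.singleton_append]
  rw [tsum_eq_single a hne, heq]
  congr 2
  -- After a failure the empty list is prepended, so the map is the identity.
  exact congrFun (congrArg DFunLike.coe (PMF.map_id _)) _

theorem repeatTrials_map_length_succ {h : List Bool} (hh : halt h = false) (n k : ℕ) :
    (repeatTrials trial halt (n + 1) h).map List.length (k + 1) =
      trial none * (repeatTrials trial halt n (false :: h)).map List.length (k + 1) +
        (∑' a, trial (some a)) * (repeatTrials trial halt n (true :: h)).map List.length k := by
  rw [repeatTrials_succ hh, PMF.map_bind, PMF.bind_apply, tsum_option_ennreal,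
    ← ENNReal.tsum_mul_right]
  simp only [Option.isSome_none, Option.isSome_some, Option.toList_none, Option.toList_some,
    List.nil_append, List.singleton_append, PMF.map_comp]
  congr 1
  refine tsum_congr fun a => ?_
  simp only [PMF.map_apply, Function.comp_apply, List.length_cons, Nat.add_right_cancel_iff]
  congr!

theorem map_length_zero (X : PMF (List α)) : X.map List.length 0 = X [] := by
  rw [PMF.map_apply, tsum_eq_single [], List.length_nil, if_pos rfl]
  intro l hl
  rw [if_neg]
  intro h
  exact hl (List.length_eq_zero_iff.1 h.symm)

theorem repeatTrials_support (h₀ : ∀ a ∉ S, trial (some a) = 0) (n : ℕ) (h : List Bool) :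
    ∀ l ∈ (repeatTrials trial halt n h).support, ∀ x ∈ l, x ∈ S := by
  induction n generalizing h with
  | zero => simp [repeatTrials]
  | succ n ih =>
    cases hh : halt h with
    | true => simp [repeatTrials_of_halt hh]
    | false =>
      intro l hl x hx
      rw [repeatTrials_succ hh, PMF.mem_support_bind_iff] at hl
      obtain ⟨o, ho, hl⟩ := hl
      obtain ⟨l', hl', rfl⟩ := (PMF.mem_support_map_iff _ _ _).1 hl
      rcases List.mem_append.1 hx with hx | hx
      · by_contra hxS
        rw [Option.mem_toList] at hx
        subst hx
        exact (PMF.mem_support_iff _ _).1 ho (h₀ x hxS)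
      · exact ih _ l' hl' x hx

/-- If each trial is uniform on `S` given that it succeeds, then the recorded outcomes are a uniform
sample from `S`, whatever the halting rule. -/
theorem isUniformListSample_repeatTrials {c : ℝ≥0∞} (hc : ∀ a ∈ S, trial (some a) = c)
    (h₀ : ∀ a ∉ S, trial (some a) = 0) (n : ℕ) (h : List Bool) :
    IsUniformListSample S (repeatTrials trial halt n h) := by
  refine ⟨repeatTrials_support h₀ n h, ?_⟩
  -- The success probability of a trial, which drives the recursion for the length.
  have htot : ∑' a, trial (some a) = S.card * c := by
    rw [tsum_eq_sum h₀, Finset.sum_congr rfl hc, Finset.sum_const, nsmul_eq_mul]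
  induction n generalizing h with
  | zero =>
    rintro (_ | ⟨a, l⟩) - <;> simp [repeatTrials, PMF.pure_map]
  | succ n ih =>
    cases hh : halt h with
    | true => rintro (_ | ⟨a, l⟩) - <;> simp [repeatTrials_of_halt hh, PMF.pure_map]
    | false =>
      rintro (_ | ⟨a, l⟩) hl
      · rw [List.length_nil, map_length_zero, pow_zero, mul_one]
      · have ha : a ∈ S := hl a (by simp)
        have hS : (S.card : ℝ≥0∞) ≠ 0 := Nat.cast_ne_zero.2 (Finset.card_ne_zero_of_mem ha)
        rw [List.length_cons, repeatTrials_cons hh, repeatTrials_map_length_succ hh, ih _ _ hl,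
          ih _ l fun x hx => hl x (by simp [hx]), hc a ha, htot, add_mul, List.length_cons,
          ← mul_assoc, pow_succ]
        congr 1
        -- Recording `a` has probability `c`, the success probability `|S| * c` times `|S|⁻¹`; here
        -- `S` is nonempty because it contains `a`.
        have hcancel := ENNReal.mul_inv_cancel hS (ENNReal.natCast_ne_top _)
        calc _ = ((S.card : ℝ≥0∞) * (S.card : ℝ≥0∞)⁻¹) * (c *
              ((repeatTrials trial halt n (true :: h)).map List.length l.length *
                (S.card : ℝ≥0∞)⁻¹ ^ l.length)) := by rw [hcancel, one_mul]
          _ = _ := by ring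

theorem exists_mem_support_repeatTrials (hh : halt [] = false) {n : ℕ} (hn : 0 < n) {a : α}
    (ha : trial (some a) ≠ 0) : ∃ l ∈ (repeatTrials trial halt n []).support, a ∈ l := by
  obtain ⟨n, rfl⟩ := Nat.exists_eq_succ_of_ne_zero hn.ne'
  obtain ⟨l, hl⟩ := (repeatTrials trial halt n [true]).support_nonempty
  refine ⟨a :: l, ?_, by simp⟩
  rw [Nat.succ_eq_add_one, repeatTrials_succ hh, PMF.mem_support_bind_iff]
  exact ⟨some a, ha, (PMF.mem_support_map_iff _ _ _).2 ⟨l, hl, rfl⟩⟩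

end Repetition

/-! ### From uniform lists to uniform sets. -/

section Uniform

variable {α : Type*} [Finite α] [DecidableEq α] {S : Finset α} {X : PMF (List α)}

theorem exists_perm_image_eq {E E' : Finset α} (h : E.card = E'.card) :
    ∃ π : Equiv.Perm α, ∀ x, π x ∈ E' ↔ x ∈ E := by
  have e : {x // x ∈ E} ≃ {x // x ∈ E'} := Finset.equivOfCardEq h
  refine ⟨e.extendSubtype, fun x => ⟨fun hx => ?_, fun hx => e.extendSubtype_mem x hx⟩⟩
  by_contra hxE
  exact e.extendSubtype_not_mem x hxE hx

/-- A permutation of `α` carrying `E` to `E'` matches the lists with entry set `E` to those with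
entry set `E'` and keeps lengths, on which alone their probabilities depend. It need not preserve
`S`, as only lists with entries in `E` or `E'` count. -/
theorem IsUniformListSample.map_toFinset_congr (hX : IsUniformListSample S X) {E E' : Finset α}
    (hE : E ⊆ S) (hE' : E' ⊆ S) (h : E.card = E'.card) :
    X.map List.toFinset E = X.map List.toFinset E' := by
  obtain ⟨π, hπ⟩ := exists_perm_image_eq h
  rw [PMF.map_apply, PMF.map_apply]
  refine Eq.trans (tsum_congr fun l => ?_) ((Equiv.listEquivOfEquiv π).tsum_eq _)
  have hiff : E' = (l.map π).toFinset ↔ E = l.toFinset := by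
    simp only [Finset.ext_iff, List.mem_toFinset]
    constructor
    · intro hl x
      rw [← hπ, hl, List.mem_map_of_injective π.injective]
    · intro hl x
      obtain ⟨y, rfl⟩ := π.surjective x
      rw [hπ, hl, List.mem_map_of_injective π.injective]
  rw [show Equiv.listEquivOfEquiv π l = l.map π from rfl]
  simp only [hiff]
  split_ifs with hl
  · rw [hX.2 l fun x hx => hE (by rw [hl]; exact List.mem_toFinset.2 hx),
      hX.2 (l.map π) fun x hx => hE' (by rw [hiff.2 hl]; exact List.mem_toFinset.2 hx),
      List.length_map]
  · rfl

/-- The set of entries of a uniform sample with replacement is a uniform sample without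
replacement. -/
theorem IsUniformListSample.isUniformSetSample_toFinset (hX : IsUniformListSample S X) :
    IsUniformSetSample S (X.map List.toFinset) := by
  have := Fintype.ofFinite α
  have hsub : ∀ E ∈ (X.map List.toFinset).support, E ⊆ S := by
    intro E hE x hx
    obtain ⟨l, hl, rfl⟩ := (PMF.mem_support_map_iff _ _ _).1 hE
    exact hX.1 l hl x (List.mem_toFinset.1 hx)
  refine ⟨hsub, fun E hE => ?_⟩
  -- The event of having this cardinality splits into the equally likely subsets of `S` of that
  -- size; sets not contained in `S` have probability zero.
  have hcard : (X.map List.toFinset).map Finset.card E.card =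
      (S.card.choose E.card : ℕ) * X.map List.toFinset E := by
    rw [PMF.map_apply, tsum_eq_sum (s := S.powersetCard E.card), ← Finset.card_powersetCard,
      ← nsmul_eq_mul, ← Finset.sum_const]
    · refine Finset.sum_congr rfl fun E' hE' => ?_
      rw [Finset.mem_powersetCard] at hE'
      refine (if_pos hE'.2.symm).trans ?_
      exact hX.map_toFinset_congr hE'.1 hE hE'.2
    · intro E' hE'
      split_ifs with hc
      · by_contra hne
        exact hE' (Finset.mem_powersetCard.2
          ⟨hsub E' ((PMF.mem_support_iff _ _).2 hne), hc.symm⟩)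
      · rfl
  have hpos : ((S.card.choose E.card : ℕ) : ℝ≥0∞) ≠ 0 :=
    Nat.cast_ne_zero.2 (Nat.choose_pos (Finset.card_le_card hE)).ne'
  rw [hcard, mul_right_comm, ENNReal.mul_inv_cancel hpos (ENNReal.natCast_ne_top _), one_mul]

end Uniform

/-! ### Uniformity and support of the sampled hyperedges. -/

section Source

variable {Vq V L P : Type*} {D : P → Type*} [Fintype Vq] [DecidableEq Vq] [Fintype V]
  {G : PropertyGraph V L P D} {q : QueryGraph Vq L P D} {cs : CandidateSpace Vq V}

open Classical in
-- Sums the probability `1/W` over all matches with vertex set `ε`.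
theorem treeTrial_map_vertexSet (hcs : CandidateSpace.IsFiltered G q cs) (T : SpanningForest q)
    (ε : Finset V) : (treeTrial G cs T).map (Option.map vertexSet) (some ε) =
      Nat.card {f // IsMatching G q ε f} * (treeTotal cs T : ℝ≥0∞)⁻¹ := by
  rw [PMF.map_apply, tsum_fintype, Fintype.sum_option, Nat.card_eq_fintype_card,
    Fintype.card_subtype, ← nsmul_eq_mul, ← Finset.sum_const, Finset.sum_filter]
  simp only [Option.map_none, reduceCtorEq, if_false, zero_add, Option.map_some,
    Option.some.injEq]
  refine Finset.sum_congr rfl fun f _ => ?_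
  rw [isMatching_iff_isMatch]
  by_cases hf : IsMatch G q f
  · simp only [hf, true_and, treeTrial_some hcs T hf, eq_comm]
  · simp [hf, treeTrial_some_of_not_isMatch cs T hf]

open Classical in
theorem sourceFas_map_hyperedges (G : PropertyGraph V L P D) (cs : CandidateSpace Vq V)
    (T : SpanningForest q) (halt : List Bool → Bool) (n : ℕ) :
    (sourceFas G cs T halt n).map Hypergraph.hyperedges =
      ((sampledMatches G cs T halt n).map (List.map vertexSet)).map List.toFinset := by
  rw [sourceFas, PMF.map_comp, PMF.map_comp]
  rfl

theorem isUniformListSample_sampledMatches (hcs : CandidateSpace.IsFiltered G q cs)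
    (T : SpanningForest q) (halt : List Bool → Bool) (n : ℕ) :
    IsUniformListSample (allMatches G q) (sampledMatches G cs T halt n) :=
  isUniformListSample_repeatTrials
    (fun _ hf => treeTrial_some hcs T (mem_allMatches.1 hf))
    (fun _ hf => treeTrial_some_of_not_isMatch cs T fun h => hf (mem_allMatches.2 h)) n []

/-- Symmetric constraints make the number of matchings onto `ε` equal to the number of automorphisms
for every hyperedge `ε`, so one constant `c` serves for all. -/
theorem isUniformListSample_vertexSet (hcs : CandidateSpace.IsFiltered G q cs)
    (T : SpanningForest q) (halt : List Bool → Bool) (n : ℕ) (hq : q.SymmetricConstraints) :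
    IsUniformListSample (source G q).hyperedges
      ((sampledMatches G cs T halt n).map (List.map vertexSet)) := by
  rw [sampledMatches, repeatTrials_map]
  refine isUniformListSample_repeatTrials
    (c := Nat.card {σ // IsAutomorphism q σ} * (treeTotal cs T : ℝ≥0∞)⁻¹)
    (fun ε hε => ?_) (fun ε hε => ?_) n []
  · obtain ⟨f, hf⟩ := mem_source_hyperedges.1 hε
    rw [treeTrial_map_vertexSet hcs, hf.card_isMatching_eq hq]
  · have : IsEmpty {f // IsMatching G q ε f} :=
      ⟨fun f => hε (mem_source_hyperedges.2 ⟨f.1, f.2⟩)⟩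
    rw [treeTrial_map_vertexSet hcs, Nat.card_of_isEmpty, Nat.cast_zero, zero_mul]

theorem exists_mem_support_sourceFas (hcs : CandidateSpace.IsFiltered G q cs)
    (T : SpanningForest q) {halt : List Bool → Bool} {n : ℕ} (hn : 0 < n) (hh : halt [] = false)
    {ε : Finset V} (hε : ε ∈ (source G q).hyperedges) :
    ∃ H ∈ (sourceFas G cs T halt n).support, ε ∈ H.hyperedges := by
  classical
  obtain ⟨f, hf⟩ := mem_source_hyperedges.1 hε
  have hne : treeTrial G cs T (some f) ≠ 0 := by
    rw [treeTrial_some hcs T ⟨ε, hf⟩]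
    -- Finiteness of `W` is what makes `1/W` nonzero in `ℝ≥0∞`.
    exact ENNReal.inv_ne_zero.2 (ENNReal.natCast_ne_top _)
  obtain ⟨l, hl, hfl⟩ := exists_mem_support_repeatTrials hh hn hne
  refine ⟨_, (PMF.mem_support_map_iff _ _ _).2 ⟨l, hl, rfl⟩, ?_⟩
  exact List.mem_toFinset.2 (List.mem_map.2 ⟨f, hfl, hf.vertexSet_eq⟩)

end Source

end ExBI

theorem mainTheorem5 {Vq V L P : Type*} {D : P → Type*}
    [Fintype Vq] [DecidableEq Vq] [Fintype V]
    (G : ExBI.PropertyGraph V L P D) (q : ExBI.QueryGraph Vq L P D)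
    (cs : ExBI.CandidateSpace Vq V) (hcs : ExBI.CandidateSpace.IsFiltered G q cs)
    (T : ExBI.SpanningForest q) (halt : List Bool → Bool) (n : ℕ) :
    -- in one trial, each match is recorded with the same probability
    (∀ f ∈ ExBI.allMatches G q,
      0 < ExBI.treeTotal cs T ∧
      ExBI.treeTrial G cs T (some f) = ((ExBI.treeTotal cs T : ℕ) : ENNReal)⁻¹) ∧
    -- the recorded matches are a uniform sample from all matches
    ExBI.IsUniformListSample (ExBI.allMatches G q) (ExBI.sampledMatches G cs T halt n) ∧
    -- the hyperedges are a uniform sample from all induced subgraphs isomorphic to the query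
    (q.SymmetricConstraints →
      ExBI.IsUniformListSample (ExBI.source G q).hyperedges
        ((ExBI.sampledMatches G cs T halt n).map (List.map ExBI.vertexSet)) ∧
      ExBI.IsUniformSetSample (ExBI.source G q).hyperedges
        ((ExBI.sourceFas G cs T halt n).map ExBI.Hypergraph.hyperedges)) ∧
    -- each induced subgraph isomorphic to the query can occur as soon as a trial is made
    (0 < n → halt [] = false → ∀ ε ∈ (ExBI.source G q).hyperedges,
      ∃ H ∈ (ExBI.sourceFas G cs T halt n).support, ε ∈ H.hyperedges) := by
  classical
  refine ⟨fun f hf => ?_, ExBI.isUniformListSample_sampledMatches hcs T halt n, fun hq => ?_,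
    fun hn hh ε hε => ExBI.exists_mem_support_sourceFas hcs T hn hh hε⟩
  · have hf := ExBI.mem_allMatches.1 hf
    exact ⟨(hcs.carries hf).treeTotal_pos T, ExBI.treeTrial_some hcs T hf⟩
  · have hX := ExBI.isUniformListSample_vertexSet hcs T halt n hq
    refine ⟨hX, ?_⟩
    rw [ExBI.sourceFas_map_hyperedges]
    convert hX.isUniformSetSample_toFinset
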